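/- Let $\boldsymbol\xi$ be an $m$-dimensional random vector and $g:\mathbb{R}^m\times\mathbb{R}^n\to\mathbb{R}$ such that $g(\boldsymbol\xi,x)$ is integrable for every $x\in\mathbb{R}^n$. For $\alpha\in(0,1)$ let $q_\alpha(x)=\min\{t\in\mathbb{R} : \mathrm{prob}\{g(\boldsymbol\xi,x)\le t\}\ge\alpha\}$ be the $\alpha$-quantile of $g(\boldsymbol\xi,x)$, and let the $\alpha$-superquantile be $$\bar q_\alpha(x)=q_\alpha(x)+\frac{1}{1-\alpha}\,\mathbb{E}\big[\max\{0,\,g(\boldsymbol\xi,x)-q_\alpha(x)\}\big],\qquad \alpha\in(0,1),$$ with $\bar q_0(x)=\mathbb{E}[g(\boldsymbol\xi,x)]$ and $\bar q_1(x)=\lim_{\alpha\nearrow1}\bar q_\alpha(x)\in(-\infty,\infty]$. The buffered failure probability is $$\bar p(x)=\begin{cases}0&\text{if }\mathrm{prob}\{g(\boldsymbol\xi,x)>0\}=0,\\ 1-\bar\alpha&\text{if }\mathrm{prob}\{g(\boldsymbol\xi,x)>0\}>0\text{ and }\mathbb{E}[g(\boldsymbol\xi,x)]<0,\\ 1&\text{otherwise,}\end{cases}$$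 where $\bar\alpha$ is the (unique) $\alpha\in[0,1]$ with $\bar q_\alpha(x)=0$. Let $$\Gamma(x)=\operatorname*{argmin}_{\gamma\ge0}\ \mathbb{E}\big[\max\{0,\,\gamma g(\boldsymbol\xi,x)+1\}\big].$$ For a closed set $C\subset\mathbb{R}^n$ and $x\in C$, a vector $v$ is a regular normal to $C$ at $x$ if $\langle v,y-x\rangle\le o(\|y-x\|)$ for $y\in C$, $y\to x$; the limiting normal cone $N_C(x)$ is the set of all limits of sequences $v^k$ where $v^k$ is a regular normal to $C$ at $x^k\in C$ and $x^k\to x$. Suppose that $\hat x\in\mathbb{R}^n$, $\boldsymbol\xi$ and $g$ satisfy: (a) $\boldsymbol\xi$ has a finite distribution with outcomes $\xi^1,\dots,\xi^\nu$ and corresponding positive probabilities $p_1,\dots,p_\nu$; (b) for every $i=1,\dots,\nu$ the function $g(\xi^i,\cdot)$ is continuously differentiable in a neighborhood of $\hat x$; (c) $\mathbb{E}[g(\boldsymbol\xi,\hat x)]<0$, and $g(\xi^i,\hat x)>0$ for some $i$. Then $\bar p$ is Lipschitz continuous on some neighborhood of $\hat x$. Moreover, for every nonempty closed set $C\subset\mathbb{R}^n$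 such that $\hat x\in C$ is a local minimizer of $\bar p$ over $C$, there are $\hat\gamma\in\Gamma(\hat x)$ and multipliers $\mu_1,\dots,\mu_\nu\in[0,1]$ with $$\sum_{i=1}^\nu p_i\mu_i\,g(\xi^i,\hat x)=0$$ and, for all $i$, $\mu_i=0$ if $\hat\gamma g(\xi^i,\hat x)+1<0$ and $\mu_i=1$ if $\hat\gamma g(\xi^i,\hat x)+1>0$ (and $\mu_i\in[0,1]$ arbitrary if $\hat\gamma g(\xi^i,\hat x)+1=0$), such that $$-\hat\gamma\sum_{i=1}^\nu p_i\mu_i\,\nabla_x g(\xi^i,\hat x)\in N_C(\hat x).$$ -/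

import Mathlib

open MeasureTheory Filter Topology

namespace BufferedFailure

noncomputable section

/-- The `α`-quantile, `0 < α < 1`, of the random variable `X`: the smallest `t` with
`prob {X ≤ t} ≥ α`. -/
def quantile {Ω : Type*} [MeasurableSpace Ω] (P : Measure Ω) (X : Ω → ℝ) (α : ℝ) : ℝ :=
  sInf {t : ℝ | α ≤ P.real {ω | X ω ≤ t}}

/-- The expression `q_α + (1 - α)⁻¹ E[max {0, X - q_α}]`, used for `0 < α < 1`. -/
def tailMean {Ω : Type*} [MeasurableSpace Ω] (P : Measure Ω) (X : Ω → ℝ) (α : ℝ) : ℝ :=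
  quantile P X α + 1 / (1 - α) * ∫ ω, max 0 (X ω - quantile P X α) ∂P

/-- The `α`-superquantile, `0 ≤ α ≤ 1`, of an integrable random variable `X`. At `α = 0` it is the
expectation (the value of the defining expression when the `0`-quantile is replaced by any lower
bound of `X`, and its limit as `α` decreases to `0`). At `α = 1` it is the limit of the
`α`-superquantiles as `α` increases to `1`, which is `∞` when `X` is not bounded above; hence the
values in `EReal`. -/
def superquantile {Ω : Type*} [MeasurableSpace Ω] (P : Measure Ω) (X : Ω → ℝ) (α : ℝ) : EReal :=
  if α = 0 then ((∫ ω, X ω ∂P : ℝ) : EReal)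
  else if α < 1 then ((tailMean P X α : ℝ) : EReal)
  else limUnder (𝓝[<] (1 : ℝ)) (fun a : ℝ => ((tailMean P X a : ℝ) : EReal))

open Classical in
/-- The buffered probability of `{X > 0}` for an integrable random variable `X`. In the second case
there is exactly one `α ∈ [0, 1]` whose superquantile vanishes, and `sInf` picks it. -/
def bprob {Ω : Type*} [MeasurableSpace Ω] (P : Measure Ω) (X : Ω → ℝ) : ℝ :=
  if P {ω | 0 < X ω} = 0 then 0
  else if ∫ ω, X ω ∂P < 0 then
    1 - sInf {α : ℝ | α ∈ Set.Icc (0 : ℝ) 1 ∧ superquantile P X α = 0}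
  else 1

/-- The buffered failure probability `x ↦ bprob {g(ξ, x) > 0}`. -/
def bufferedFailureProb {Ω : Type*} [MeasurableSpace Ω] {S E : Type*} (P : Measure Ω) (ξ : Ω → S)
    (g : S → E → ℝ) (x : E) : ℝ :=
  bprob P (fun ω => g (ξ ω) x)

/-- The set `Γ(x)` of minimizers over `γ ≥ 0` of `E[max {0, γ g(ξ, x) + 1}]`. -/
def Γset {Ω : Type*} [MeasurableSpace Ω] {S E : Type*} (P : Measure Ω) (ξ : Ω → S)
    (g : S → E → ℝ) (x : E) : Set ℝ :=
  {γ : ℝ | 0 ≤ γ ∧ ∀ γ' : ℝ, 0 ≤ γ' →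
    ∫ ω, max 0 (γ * g (ξ ω) x + 1) ∂P ≤ ∫ ω, max 0 (γ' * g (ξ ω) x + 1) ∂P}

/-- The random element `ξ` has a finite distribution with outcomes `s i` and corresponding positive
probabilities `p i`. -/
def HasFiniteDistribution {Ω S : Type*} [MeasurableSpace Ω] [MeasurableSpace S] (P : Measure Ω)
    (ξ : Ω → S) {ν : ℕ} (s : Fin ν → S) (p : Fin ν → ℝ) : Prop :=
  Measurable ξ ∧ (∀ i, 0 < p i) ∧ P.map ξ = ∑ i, ENNReal.ofReal (p i) • Measure.dirac (s i)

/-- `v` is a regular (Fréchet) normal to `C` at `x`: `x ∈ C` and `⟪v, y - x⟫ ≤ o(‖y - x‖)` for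
`y ∈ C`. -/
def regularNormalCone {E : Type*} [NormedAddCommGroup E] [InnerProductSpace ℝ E] (C : Set E)
    (x : E) : Set E :=
  {v : E | x ∈ C ∧ ∀ ε : ℝ, 0 < ε → ∀ᶠ y in 𝓝[C] x, inner ℝ v (y - x) ≤ ε * ‖y - x‖}

/-- The limiting (Mordukhovich) normal cone of `C` at `x`: limits of regular normals at points of
`C` that converge to `x`. -/
def limitingNormalCone {E : Type*} [NormedAddCommGroup E] [InnerProductSpace ℝ E] (C : Set E)
    (x : E) : Set E :=
  {v : E | x ∈ C ∧ ∃ (y : ℕ → E) (w : ℕ → E), (∀ k, w k ∈ regularNormalCone C (y k)) ∧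
    Tendsto y atTop (𝓝 x) ∧ Tendsto w atTop (𝓝 v)}

end

end BufferedFailure

open BufferedFailure

/-!
For an integrable random variable `X` with `E[X] < 0` and `P {X > 0} > 0`, the buffered probability
is the minimum over `γ ≥ 0` of `E[max {0, γ X + 1}]` (`exists_bprob_eq`). Indeed, the quantile
minimizes the Rockafellar–Uryasev function `t ↦ t + (1 - α)⁻¹ E[max {0, X - t}]`, whose minimum is
the superquantile (`quantile_isMin`), and the substitution `t = -1 / γ` turns the equation
"superquantile at level `α` is zero" into "the minimum over `γ` is `1 - α`".

For a finite distribution and `X = g(ξ, x)` the function being minimized is the sum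
`hingeSum p G γ x = ∑ i, p i * max 0 (γ * G i x + 1)`, where `G i = g(ξⁱ, ·)`. An outcome with
`G i > 0` keeps the minimizers `γ` bounded near the reference point, and a minimum of uniformly
Lipschitz functions is Lipschitz (`lipschitzOnWith_of_isMin_hingeSum`).

If `x₀` is a local minimizer over `C` of the buffered failure probability, and `γ₀` attains the
minimum there, then `(γ₀, x₀)` is a local minimizer of the hinge sum over `[0, ∞) × C`, with
`γ₀ > 0`. The multiplier rule at such a point (`exists_multipliers`) needs no calculus of
subdifferentials. Replace `max 0 t` by `(t + √(t² + ε²)) / 2` and relax the constraint on `x` to a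
penalty `κ / 2 * ‖x - y‖²` with `y ∈ C`, adding proximal terms at `(γ₀, x₀)`. As `ε → 0` and
`κ → ∞` the minimizers `(γ, x, y)` converge to `(γ₀, x₀, x₀)` (`penalty_terms_le`), so that they are
eventually interior. Then the derivatives in `γ` and `x` vanish, and `κ (x - y)` is a regular normal
to `C` at `y`. The derivatives of the smoothed positive part lie in `[0, 1]`; a limit point of them
gives the multipliers, and the equation in `x` shows that `κ (x - y)` converges to the vector
claimed to be a limiting normal.
-/

/-! ### Quantiles and the minimization formula for superquantiles -/

namespace BufferedFailure

section Superquantile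

variable {Ω : Type*} [MeasurableSpace Ω] {P : Measure Ω} [IsProbabilityMeasure P] {X : Ω → ℝ}
  {α : ℝ}

lemma measureReal_le_eq_cdf (hX : AEMeasurable X P) (t : ℝ) :
    P.real {ω | X ω ≤ t} = ProbabilityTheory.cdf (P.map X) t := by
  have := Measure.isProbabilityMeasure_map hX
  rw [ProbabilityTheory.cdf_eq_real, map_measureReal_apply_of_aemeasurable hX measurableSet_Iic]
  rfl

lemma measureReal_le_lt_of_lt_quantile (hX : AEMeasurable X P) (h0 : 0 < α) {t : ℝ}
    (ht : t < quantile P X α) : P.real {ω | X ω ≤ t} < α := by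
  by_contra! h
  have hbdd : BddBelow {t : ℝ | α ≤ P.real {ω | X ω ≤ t}} := by
    obtain ⟨b, hb⟩ := eventually_atBot.1
      ((ProbabilityTheory.tendsto_cdf_atBot (P.map X)).eventually_lt_const h0)
    refine ⟨b, fun u hu => ?_⟩
    by_contra! hlt
    exact absurd (hb u hlt.le) (not_lt.2 (measureReal_le_eq_cdf hX u ▸ hu))
  exact absurd (csInf_le hbdd h) (not_le.2 ht)

lemma le_measureReal_le_of_quantile_lt (hX : AEMeasurable X P) (h1 : α < 1) {t : ℝ}
    (ht : quantile P X α < t) : α ≤ P.real {ω | X ω ≤ t} := by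
  have hne : {t : ℝ | α ≤ P.real {ω | X ω ≤ t}}.Nonempty := by
    obtain ⟨b, hb⟩ := eventually_atTop.1
      ((ProbabilityTheory.tendsto_cdf_atTop (P.map X)).eventually_const_lt h1)
    exact ⟨b, (hb b le_rfl).le.trans_eq (measureReal_le_eq_cdf hX b).symm⟩
  obtain ⟨u, hu, hut⟩ := exists_lt_of_csInf_lt hne ht
  exact le_trans hu (measureReal_mono fun ω hω => le_trans hω hut.le)

/-- Integration of the lower bound of `Y` by the simple function with value `a + c` on `{X ≤ u}` and
`a` elsewhere. -/
lemma add_mul_measureReal_le_integral (hX : AEMeasurable X P) {Y : Ω → ℝ} (hY : Integrable Y P)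
    {a c u : ℝ} (hle : ∀ ω, X ω ≤ u → a + c ≤ Y ω) (hgt : ∀ ω, u < X ω → a ≤ Y ω) :
    a + c * P.real {ω | X ω ≤ u} ≤ ∫ ω, Y ω ∂P := by
  have hs : NullMeasurableSet {ω | X ω ≤ u} P := nullMeasurableSet_le hX aemeasurable_const
  have hi : Integrable ({ω | X ω ≤ u}.indicator fun _ => c) P :=
    (integrable_const c).indicator₀ hs
  have h : ∫ ω, (a + {ω | X ω ≤ u}.indicator (fun _ => c) ω) ∂P = a + c * P.real {ω | X ω ≤ u} := by
    rw [integral_add (integrable_const a) hi, integral_indicator₀ hs]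
    simp [mul_comm]
  rw [← h]
  refine integral_mono ((integrable_const a).add hi) hY fun ω => ?_
  by_cases hω : X ω ≤ u
  · simpa [Set.indicator, hω] using hle ω hω
  · simpa [Set.indicator, hω] using hgt ω (not_le.1 hω)

lemma integrable_max_zero_sub (hX : Integrable X P) (t : ℝ) :
    Integrable (fun ω => max 0 (X ω - t)) P := by
  simpa [max_comm] using (hX.sub (integrable_const t)).pos_part

lemma integrable_max_zero_mul_add_one (hX : Integrable X P) (γ : ℝ) :
    Integrable (fun ω => max 0 (γ * X ω + 1)) P := by
  simpa [max_comm] using ((hX.const_mul γ).add (integrable_const 1)).pos_part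

/-- The quantile minimizes the Rockafellar–Uryasev function `t ↦ t + (1 - α)⁻¹ E[max {0, X - t}]`,
here multiplied by `1 - α`: the product is convex in `t`, with one-sided derivatives
`P {X < t} - α` and `P {X ≤ t} - α`. -/
lemma quantile_isMin (hX : Integrable X P) (h0 : 0 < α) (h1 : α < 1) (t : ℝ) :
    (1 - α) * quantile P X α + ∫ ω, max 0 (X ω - quantile P X α) ∂P ≤
      (1 - α) * t + ∫ ω, max 0 (X ω - t) ∂P := by
  set q := quantile P X α
  have hit := integrable_max_zero_sub hX t
  have hiq := integrable_max_zero_sub hX q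
  have key : (1 - α) * (q - t) ≤ ∫ ω, (max 0 (X ω - t) - max 0 (X ω - q)) ∂P := by
    set I := ∫ ω, (max 0 (X ω - t) - max 0 (X ω - q)) ∂P with hI
    rcases lt_trichotomy t q with h | h | h
    · -- every level `u` between `t` and `q` has `P {X > u} ≥ 1 - α`; then let `u` tend to `q`
      by_contra! hlt
      have hlt' : I / (1 - α) + t < q := by
        have := (div_lt_iff₀' (by linarith : 0 < 1 - α)).2 hlt
        linarith
      obtain ⟨u, hu, huq⟩ := exists_between (max_lt h hlt')
      obtain ⟨htu, hIu⟩ := max_lt_iff.1 hu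
      have h2 := measureReal_le_lt_of_lt_quantile hX.aemeasurable h0 huq
      have h3 : u - t + -(u - t) * P.real {ω | X ω ≤ u} ≤ I := by
        refine add_mul_measureReal_le_integral hX.aemeasurable (hit.sub hiq)
          (fun ω hω => ?_) fun ω hω => ?_
        · change _ ≤ max 0 (X ω - t) - max 0 (X ω - q)
          rw [max_eq_left (by linarith : X ω - q ≤ 0)]
          linarith [le_max_left 0 (X ω - t)]
        · change _ ≤ max 0 (X ω - t) - max 0 (X ω - q)
          rw [max_eq_right (by linarith : 0 ≤ X ω - t)]
          rcases max_cases 0 (X ω - q) with h | h <;> linarith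
      have h4 : I < (1 - α) * (u - t) :=
        (div_lt_iff₀' (by linarith : 0 < 1 - α)).1 (by linarith)
      nlinarith
    · simp [hI, h]
    · -- every level `u` between `q` and `t` has `P {X ≤ u} ≥ α`; then let `u` tend to `q`
      by_contra! hlt
      have hlt' : q < t - (I + (t - q)) / α := by
        have : (I + (t - q)) / α < t - q := (div_lt_iff₀' h0).2 (by linarith)
        linarith
      obtain ⟨u, hqu, hu⟩ := exists_between (lt_min h hlt')
      obtain ⟨hut, hIu⟩ := lt_min_iff.1 hu
      have h2 := le_measureReal_le_of_quantile_lt hX.aemeasurable h1 hqu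
      have h3 : -(t - q) + (t - u) * P.real {ω | X ω ≤ u} ≤ I := by
        refine add_mul_measureReal_le_integral hX.aemeasurable (hit.sub hiq)
          (fun ω hω => ?_) fun ω hω => ?_
        · change _ ≤ max 0 (X ω - t) - max 0 (X ω - q)
          rw [max_eq_left (by linarith : X ω - t ≤ 0)]
          rcases max_cases 0 (X ω - q) with h | h <;> linarith
        · change _ ≤ max 0 (X ω - t) - max 0 (X ω - q)
          rw [max_eq_right (by linarith : 0 ≤ X ω - q)]
          linarith [le_max_right 0 (X ω - t)]
      have h4 : I + (t - q) < α * (t - u) := (div_lt_iff₀' h0).1 (by linarith)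
      nlinarith
  rw [integral_sub hit hiq] at key
  linarith

end Superquantile

/-! ### The buffered probability as a minimum -/

lemma integral_max_zero_mul_add_one_eq {Ω : Type*} [MeasurableSpace Ω]
    {P : Measure Ω} {X : Ω → ℝ} {γ : ℝ} (hγ : 0 < γ) :
    ∫ ω, max 0 (γ * X ω + 1) ∂P = γ * ∫ ω, max 0 (X ω - -γ⁻¹) ∂P := by
  rw [← integral_const_mul]
  refine integral_congr_ae (ae_of_all _ fun ω => ?_)
  change _ = γ * max 0 _
  rw [mul_max_of_nonneg _ _ hγ.le, mul_zero, sub_neg_eq_add, mul_add, mul_inv_cancel₀ hγ.ne']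

section Bprob

variable {Ω : Type*} [MeasurableSpace Ω] {P : Measure Ω} [IsProbabilityMeasure P] {X : Ω → ℝ}

lemma integral_max_zero_pos (hX : Integrable X P) (hpos : P {ω | 0 < X ω} ≠ 0) :
    0 < ∫ ω, max 0 (X ω) ∂P := by
  have hi : Integrable (fun ω => max 0 (X ω)) P := by simpa using integrable_max_zero_sub hX 0
  refine (integral_pos_iff_support_of_nonneg (fun ω => le_max_left 0 (X ω)) hi).2 ?_
  convert pos_iff_ne_zero.2 hpos using 2
  ext ω
  simp

lemma mul_integral_le_integral_max (hX : Integrable X P) {γ : ℝ} (hγ : 0 ≤ γ) :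
    γ * ∫ ω, max 0 (X ω) ∂P ≤ ∫ ω, max 0 (γ * X ω + 1) ∂P := by
  rw [← integral_const_mul]
  have hi : Integrable (fun ω => max 0 (X ω)) P := by simpa using integrable_max_zero_sub hX 0
  refine integral_mono (hi.const_mul γ) (integrable_max_zero_mul_add_one hX γ) fun ω => ?_
  change γ * max 0 _ ≤ _
  rw [mul_max_of_nonneg _ _ hγ, mul_zero]
  exact max_le_max le_rfl (by linarith)

lemma continuous_integral_max (hX : Integrable X P) :
    Continuous fun γ : ℝ => ∫ ω, max 0 (γ * X ω + 1) ∂P := by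
  refine continuous_iff_continuousAt.2 fun γ₀ => ?_
  refine continuousAt_of_dominated (bound := fun ω => (|γ₀| + 1) * |X ω| + 1)
    (Eventually.of_forall fun γ => (integrable_max_zero_mul_add_one hX γ).aestronglyMeasurable)
    ?_ ((hX.abs.const_mul _).add (integrable_const 1)) (ae_of_all _ fun ω => by fun_prop)
  filter_upwards [Metric.ball_mem_nhds γ₀ one_pos] with γ hγ
  refine ae_of_all _ fun ω => ?_
  have h1 : |γ| ≤ |γ₀| + 1 := by
    have := abs_sub_abs_le_abs_sub γ γ₀
    rw [Metric.mem_ball, Real.dist_eq] at hγ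
    linarith
  rw [Real.norm_of_nonneg (le_max_left _ _)]
  have h2 : γ * X ω ≤ (|γ₀| + 1) * |X ω| :=
    (le_abs_self _).trans ((abs_mul _ _).trans_le (by gcongr))
  exact max_le (by positivity) (by linarith)

/-- The minimum over `γ ≥ 0` of `E[max {0, γ X + 1}]` is attained, at a positive `γ`, and it lies
strictly between `0` and `1`. -/
lemma exists_isMin_integral_max (hX : Integrable X P) (hneg : ∫ ω, X ω ∂P < 0)
    (hpos : P {ω | 0 < X ω} ≠ 0) :
    ∃ γ : ℝ, 0 < γ ∧ 0 < ∫ ω, max 0 (γ * X ω + 1) ∂P ∧ ∫ ω, max 0 (γ * X ω + 1) ∂P < 1 ∧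
      ∀ γ' : ℝ, 0 ≤ γ' → ∫ ω, max 0 (γ * X ω + 1) ∂P ≤ ∫ ω, max 0 (γ' * X ω + 1) ∂P := by
  obtain ⟨γ₀, hγ₀, hlt⟩ : ∃ γ : ℝ, 0 ≤ γ ∧ ∫ ω, max 0 (γ * X ω + 1) ∂P < 1 := by
    -- the difference quotient of `γ ↦ E[max {0, γ X + 1}]` at `0` with step `1 / (n + 1)` is
    -- `E[max {-(n + 1), X}]`, which tends to `E[X] < 0`
    have hlim : Tendsto (fun n : ℕ => ∫ ω, max (-((n : ℝ) + 1)) (X ω) ∂P) atTop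
        (𝓝 (∫ ω, X ω ∂P)) := by
      refine tendsto_integral_of_dominated_convergence (fun ω => |X ω|)
        (fun n => aestronglyMeasurable_const.sup hX.aestronglyMeasurable) hX.abs
        (fun n => ae_of_all _ fun ω => ?_) (ae_of_all _ fun ω => ?_)
      · rw [Real.norm_eq_abs, abs_le]
        have hn : (0 : ℝ) ≤ n := n.cast_nonneg
        exact ⟨(neg_abs_le _).trans (le_max_right _ _),
          max_le (by linarith [abs_nonneg (X ω)]) (le_abs_self _)⟩
      · refine tendsto_const_nhds.congr' ?_
        filter_upwards [eventually_ge_atTop ⌈-X ω⌉₊] with n hn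
        have := Nat.ceil_le.1 hn
        exact (max_eq_right (by linarith)).symm
    obtain ⟨n, hn⟩ := (hlim.eventually_lt_const hneg).exists
    have hn0 : (0 : ℝ) < n + 1 := by positivity
    refine ⟨((n : ℝ) + 1)⁻¹, by positivity, ?_⟩
    have h : ∀ ω, max 0 (((n : ℝ) + 1)⁻¹ * X ω + 1) =
        ((n : ℝ) + 1)⁻¹ * max (-((n : ℝ) + 1)) (X ω) + 1 := by
      intro ω
      rw [mul_max_of_nonneg _ _ (inv_nonneg.2 hn0.le), mul_neg, inv_mul_cancel₀ hn0.ne',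
        ← max_add_add_right, neg_add_cancel]
    have hi : Integrable (fun ω => max (-((n : ℝ) + 1)) (X ω)) P := (integrable_const _).sup hX
    simp_rw [h]
    rw [integral_add (hi.const_mul _) (integrable_const 1), integral_const_mul]
    have := mul_neg_of_pos_of_neg (inv_pos.2 hn0) hn
    simpa using this
  have hc := integral_max_zero_pos hX hpos
  set c := ∫ ω, max 0 (X ω) ∂P
  -- `E[max {0, γ X + 1}] ≥ γ c`, so that only `γ ≤ 1 / c` matter
  obtain ⟨γ, hγ, hmin⟩ := (isCompact_Icc (a := (0 : ℝ)) (b := 1 / c)).exists_isMinOn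
    ⟨0, by simp [hc.le]⟩ (continuous_integral_max hX).continuousOn
  have hle : ∀ γ' : ℝ, 0 ≤ γ' → ∫ ω, max 0 (γ' * X ω + 1) ∂P < 1 → γ' ∈ Set.Icc 0 (1 / c) := by
    intro γ' h0 h1
    refine ⟨h0, (le_div_iff₀ hc).2 ?_⟩
    exact (mul_integral_le_integral_max hX h0).trans h1.le
  have hγ1 : ∫ ω, max 0 (γ * X ω + 1) ∂P < 1 := (hmin (hle γ₀ hγ₀ hlt)).trans_lt hlt
  have hγ0 : 0 < γ := hγ.1.lt_of_ne fun h => by simp [← h] at hγ1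
  refine ⟨γ, hγ0, ?_, hγ1, fun γ' hγ' => ?_⟩
  · exact (mul_pos hγ0 hc).trans_le (mul_integral_le_integral_max hX hγ.1)
  · by_cases h : ∫ ω, max 0 (γ' * X ω + 1) ∂P < 1
    · exact hmin (hle γ' hγ' h)
    · exact hγ1.le.trans (not_lt.1 h)

/-- In its second case, the buffered probability is the minimum over `γ ≥ 0` of
`E[max {0, γ X + 1}]`. A minimizer `γ` corresponds to the quantile `-1 / γ` at the level at which
the superquantile vanishes. -/
theorem exists_bprob_eq (hX : Integrable X P) (hneg : ∫ ω, X ω ∂P < 0)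
    (hpos : P {ω | 0 < X ω} ≠ 0) :
    ∃ γ : ℝ, 0 < γ ∧ bprob P X = ∫ ω, max 0 (γ * X ω + 1) ∂P ∧
      ∀ γ' : ℝ, 0 ≤ γ' → bprob P X ≤ ∫ ω, max 0 (γ' * X ω + 1) ∂P := by
  obtain ⟨γ, hγ, h0, h1, hmin⟩ := exists_isMin_integral_max hX hneg hpos
  suffices h : bprob P X = ∫ ω, max 0 (γ * X ω + 1) ∂P from
    ⟨γ, hγ, h, fun γ' hγ' => h ▸ hmin γ' hγ'⟩
  set M := ∫ ω, max 0 (γ * X ω + 1) ∂P with hM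
  rw [bprob, if_neg hpos, if_pos hneg]
  suffices h : IsLeast {α : ℝ | α ∈ Set.Icc (0 : ℝ) 1 ∧ superquantile P X α = 0} (1 - M) by
    rw [h.csInf_eq]; ring
  -- the Rockafellar–Uryasev function at level `1 - M` is nonnegative ...
  have hnonneg : ∀ t : ℝ, 0 ≤ M * t + ∫ ω, max 0 (X ω - t) ∂P := by
    intro t
    have hI : 0 ≤ ∫ ω, max 0 (X ω - t) ∂P := integral_nonneg fun ω => le_max_left _ _
    rcases le_or_gt 0 t with ht | ht
    · positivity
    · have hs : (0 : ℝ) < -t⁻¹ := by simpa using ht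
      have h2 := hmin _ hs.le
      rw [integral_max_zero_mul_add_one_eq hs] at h2
      have h3 := mul_le_mul_of_nonneg_left h2 (by linarith : 0 ≤ -t)
      have h4 : -t * (-t⁻¹ * ∫ ω, max 0 (X ω - -(-t⁻¹)⁻¹) ∂P) = ∫ ω, max 0 (X ω - t) ∂P := by
        rw [inv_neg, inv_inv, neg_neg]
        field_simp [ht.ne]
      linarith
  -- ... and vanishes at `-1 / γ`
  have hzero : M * -γ⁻¹ + ∫ ω, max 0 (X ω - -γ⁻¹) ∂P = 0 := by
    rw [hM, integral_max_zero_mul_add_one_eq hγ]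
    field_simp
    ring
  refine ⟨⟨⟨by linarith, by linarith⟩, ?_⟩, ?_⟩
  · -- the quantile minimizes that function, so the superquantile at level `1 - M` is zero
    rw [superquantile, if_neg (by linarith), if_pos (by linarith), EReal.coe_eq_zero, tailMean]
    have h2 := quantile_isMin hX (by linarith : 0 < 1 - M) (by linarith) (-γ⁻¹)
    have h3 := hnonneg (quantile P X (1 - M))
    rw [sub_sub_cancel] at h2 ⊢
    field_simp
    linarith
  · -- a level where the superquantile is zero is at least `1 - M`; the case of level `1`, where
    -- the superquantile is a limit, is immediate
    rintro α ⟨⟨hα0, hα1⟩, hα⟩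
    rcases hα0.eq_or_lt with rfl | hα0
    · rw [superquantile, if_pos rfl, EReal.coe_eq_zero] at hα
      exact absurd hα hneg.ne
    rcases hα1.eq_or_lt with rfl | hα1
    · linarith
    rw [superquantile, if_neg hα0.ne', if_pos hα1, EReal.coe_eq_zero, tailMean] at hα
    have hα' : 0 < 1 - α := by linarith
    have h2 := quantile_isMin hX hα0 hα1 (-γ⁻¹)
    have h3 : (1 - α) * quantile P X α + ∫ ω, max 0 (X ω - quantile P X α) ∂P = 0 := by
      field_simp at hα
      linarith
    have h4 : (1 - α - M) * γ⁻¹ ≤ 0 := by linarith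
    nlinarith [inv_pos.2 hγ]

end Bprob

end BufferedFailure

/-! ### Finite distributions -/

namespace BufferedFailure

section FiniteDistribution

variable {Ω S : Type*} [MeasurableSpace Ω] [MeasurableSpace S] [MeasurableSingletonClass S]
  {P : Measure Ω} {ξ : Ω → S} {ν : ℕ} {s : Fin ν → S} {p : Fin ν → ℝ}

lemma HasFiniteDistribution.integrable_map (h : HasFiniteDistribution P ξ s p) (f : S → ℝ) :
    Integrable f (P.map ξ) := by
  rw [h.2.2, integrable_finsetSum_measure]
  exact fun i _ => (integrable_dirac (by simp)).smul_measure (by simp)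

/-- No measurability of `f` is needed, since the distribution of `ξ` is carried by finitely many
points. -/
lemma HasFiniteDistribution.integrable_comp (h : HasFiniteDistribution P ξ s p) (f : S → ℝ) :
    Integrable (fun ω => f (ξ ω)) P :=
  (h.integrable_map f).comp_measurable h.1

lemma HasFiniteDistribution.integral_comp (h : HasFiniteDistribution P ξ s p) (f : S → ℝ) :
    ∫ ω, f (ξ ω) ∂P = ∑ i, p i * f (s i) := by
  rw [← integral_map h.1.aemeasurable (h.integrable_map f).aestronglyMeasurable, h.2.2,
    integral_finsetSum_measure fun i _ => (integrable_dirac (by simp)).smul_measure (by simp)]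
  refine Finset.sum_congr rfl fun i _ => ?_
  rw [integral_smul_measure, integral_dirac, ENNReal.toReal_ofReal (h.2.1 i).le, smul_eq_mul]

lemma HasFiniteDistribution.measure_pos_ne_zero (h : HasFiniteDistribution P ξ s p) (f : S → ℝ)
    {i : Fin ν} (hi : 0 < f (s i)) : P {ω | 0 < f (ξ ω)} ≠ 0 := by
  intro h0
  have hae : ∀ᵐ ω ∂P, max 0 (f (ξ ω)) = 0 := by
    filter_upwards [measure_eq_zero_iff_ae_notMem.1 h0] with ω hω
    exact max_eq_left (not_lt.1 hω)
  have h1 := h.integral_comp fun z => max 0 (f z)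
  rw [integral_congr_ae hae, integral_zero] at h1
  have h2 : p i * max 0 (f (s i)) ≤ ∑ j, p j * max 0 (f (s j)) :=
    Finset.single_le_sum (f := fun j => p j * max 0 (f (s j)))
      (fun j _ => mul_nonneg (h.2.1 j).le (le_max_left _ _)) (Finset.mem_univ i)
  have h3 : 0 < p i * max 0 (f (s i)) := mul_pos (h.2.1 i) (lt_max_of_lt_right hi)
  linarith

end FiniteDistribution

/-! ### The hinge sum and Lipschitz continuity -/

section HingeSum

variable {ι E : Type*} [Fintype ι]

/-- The expectation `E[max {0, γ G(x) + 1}]` when `G` takes the value `G i` with probability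
`p i`. -/
noncomputable def hingeSum (p : ι → ℝ) (G : ι → E → ℝ) (γ : ℝ) (x : E) : ℝ :=
  ∑ i, p i * max 0 (γ * G i x + 1)

lemma hingeSum_le_add_dist [PseudoMetricSpace E] {p : ι → ℝ} (hp : ∀ i, 0 ≤ p i) {G : ι → E → ℝ}
    {K : ι → NNReal} {V : Set E} (hG : ∀ i, LipschitzOnWith (K i) (G i) V) {γ M : ℝ} (hγ : 0 ≤ γ)
    (hM : γ ≤ M) {x y : E} (hx : x ∈ V) (hy : y ∈ V) :
    hingeSum p G γ x ≤ hingeSum p G γ y + M * (∑ i, p i * K i) * dist x y := by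
  rw [hingeSum, hingeSum, Finset.mul_sum, Finset.sum_mul, ← Finset.sum_add_distrib]
  refine Finset.sum_le_sum fun i _ => ?_
  have h1 : G i x - G i y ≤ K i * dist x y :=
    (le_abs_self _).trans ((hG i).dist_le_mul x hx y hy)
  have h3 : γ * (G i x - G i y) ≤ M * (K i * dist x y) :=
    (mul_le_mul_of_nonneg_left h1 hγ).trans (mul_le_mul_of_nonneg_right hM (by positivity))
  have h2 : max 0 (γ * G i x + 1) ≤ max 0 (γ * G i y + 1) + M * (K i * dist x y) := by
    refine max_le (add_nonneg (le_max_left _ _) ?_) ?_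
    · exact mul_nonneg (hγ.trans hM) (by positivity)
    · linarith [le_max_right 0 (γ * G i y + 1)]
  calc _ ≤ p i * (max 0 (γ * G i y + 1) + M * (K i * dist x y)) :=
        mul_le_mul_of_nonneg_left h2 (hp i)
    _ = _ := by ring

/-- If `γ` does at least as well as `0`, then an outcome where `G` is at least `c > 0` bounds `γ`. -/
lemma le_of_hingeSum_le_one {p : ι → ℝ} (hp : ∀ i, 0 ≤ p i) {G : ι → E → ℝ} {γ c : ℝ} (hγ : 0 ≤ γ)
    {x : E} {i : ι} (hpi : 0 < p i) (hc : 0 < c) (hi : c ≤ G i x) (h : hingeSum p G γ x ≤ 1) :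
    γ ≤ (p i * c)⁻¹ := by
  have h1 : p i * max 0 (γ * G i x + 1) ≤ 1 := le_trans
    (Finset.single_le_sum (f := fun j => p j * max 0 (γ * G j x + 1))
      (fun j _ => mul_nonneg (hp j) (le_max_left _ _)) (Finset.mem_univ i)) h
  rw [← one_div, le_div_iff₀ (mul_pos hpi hc)]
  have h2 : γ * c ≤ max 0 (γ * G i x + 1) :=
    le_max_of_le_right (by linarith [mul_le_mul_of_nonneg_left hi hγ])
  linarith [mul_le_mul_of_nonneg_left h2 hpi.le]

/-- A function that on `V` is the minimum over `γ ≥ 0` of the hinge sum, attained at some `γ ≤ M`,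
is Lipschitz continuous on `V`. -/
lemma lipschitzOnWith_of_isMin_hingeSum [PseudoMetricSpace E] {p : ι → ℝ} (hp : ∀ i, 0 ≤ p i)
    {G : ι → E → ℝ} {K : ι → NNReal} {V : Set E} (hG : ∀ i, LipschitzOnWith (K i) (G i) V)
    {f : E → ℝ} {M : ℝ}
    (hf : ∀ x ∈ V, ∃ γ : ℝ, 0 ≤ γ ∧ γ ≤ M ∧ f x = hingeSum p G γ x)
    (hle : ∀ x ∈ V, ∀ γ : ℝ, 0 ≤ γ → f x ≤ hingeSum p G γ x) :
    LipschitzOnWith (Real.toNNReal (M * ∑ i, p i * K i)) f V := by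
  refine LipschitzOnWith.of_le_add_mul _ fun x hx y hy => ?_
  obtain ⟨γ, h0, hM, hfy⟩ := hf y hy
  calc f x ≤ hingeSum p G γ x := hle x hx γ h0
    _ ≤ hingeSum p G γ y + M * (∑ i, p i * K i) * dist x y :=
        hingeSum_le_add_dist hp hG h0 hM hx hy
    _ ≤ f y + Real.toNNReal (M * ∑ i, p i * K i) * dist x y := by
        rw [hfy]
        gcongr
        exact Real.le_coe_toNNReal _

end HingeSum

/-! ### A smooth approximation of the positive part -/

/-- A smooth approximation of `t ↦ max 0 t`, with smoothing parameter `ε`. -/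
noncomputable def smoothPos (ε t : ℝ) : ℝ := (t + √(t ^ 2 + ε ^ 2)) / 2

/-- The derivative of `smoothPos ε`, for `ε ≠ 0`. -/
noncomputable def smoothStep (ε t : ℝ) : ℝ := (1 + t / √(t ^ 2 + ε ^ 2)) / 2

lemma max_zero_le_smoothPos (ε t : ℝ) : max 0 t ≤ smoothPos ε t := by
  have h : |t| ≤ √(t ^ 2 + ε ^ 2) := Real.abs_le_sqrt (by nlinarith [sq_nonneg ε])
  rw [smoothPos]
  exact max_le (by linarith [neg_abs_le t]) (by linarith [le_abs_self t])

lemma smoothPos_le {ε : ℝ} (hε : 0 ≤ ε) (t : ℝ) : smoothPos ε t ≤ max 0 t + ε / 2 := by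
  have h : √(t ^ 2 + ε ^ 2) ≤ |t| + ε := by
    refine Real.sqrt_le_iff.2 ⟨by positivity, ?_⟩
    nlinarith [sq_abs t, mul_nonneg (abs_nonneg t) hε]
  rw [smoothPos]
  rcases max_cases 0 t with ⟨h1, h2⟩ | ⟨h1, h2⟩
  · rw [h1]; rw [abs_of_nonpos h2] at h; linarith
  · rw [h1]; rw [abs_of_pos h2] at h; linarith

lemma hasDerivAt_smoothPos {ε : ℝ} (hε : ε ≠ 0) (t : ℝ) :
    HasDerivAt (smoothPos ε) (smoothStep ε t) t := by
  have h0 : t ^ 2 + ε ^ 2 ≠ 0 := by positivity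
  have h : HasDerivAt (smoothPos ε) _ t := ((hasDerivAt_id t).add
    (((hasDerivAt_pow 2 t).add_const (ε ^ 2)).sqrt h0)).div_const 2
  refine h.congr_deriv ?_
  rw [smoothStep]
  congr 2
  field_simp
  simp

lemma smoothStep_mem_Icc (ε t : ℝ) : smoothStep ε t ∈ Set.Icc (0 : ℝ) 1 := by
  have h : |t| ≤ √(t ^ 2 + ε ^ 2) := Real.abs_le_sqrt (by nlinarith [sq_nonneg ε])
  have h2 : |t / √(t ^ 2 + ε ^ 2)| ≤ 1 := by
    rw [abs_div, abs_of_nonneg (Real.sqrt_nonneg _)]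
    exact div_le_one_of_le₀ h (Real.sqrt_nonneg _)
  rw [abs_le] at h2
  rw [smoothStep]
  constructor <;> linarith

lemma tendsto_smoothStep {α : Type*} {l : Filter α} {ε t : α → ℝ} {τ : ℝ} (hτ : τ ≠ 0)
    (hε : Tendsto ε l (𝓝 0)) (ht : Tendsto t l (𝓝 τ)) :
    Tendsto (fun a => smoothStep (ε a) (t a)) l (𝓝 ((1 + τ / |τ|) / 2)) := by
  have h : Tendsto (fun a => √(t a ^ 2 + ε a ^ 2)) l (𝓝 |τ|) := by
    have := ((ht.pow 2).add (hε.pow 2)).sqrt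
    simpa [Real.sqrt_sq_eq_abs] using this
  exact ((ht.div h (abs_ne_zero.2 hτ)).const_add 1).div_const 2

end BufferedFailure

/-! ### The penalized problem and its stationarity conditions -/

namespace BufferedFailure

section Penalized

variable {ι E : Type*} [Fintype ι] [NormedAddCommGroup E]
  {p : ι → ℝ} {G : ι → E → ℝ} {x₀ : E} {γ₀ ε κ : ℝ}

/-- The smoothed hinge sum with the constraint `x ∈ C` relaxed: the variable `y`, which is to range
over `C`, is tied to `x` by a quadratic penalty with weight `κ`, and two proximal terms single out
the reference point `(γ₀, x₀)`. -/
noncomputable def penalized (p : ι → ℝ) (G : ι → E → ℝ) (x₀ : E) (γ₀ ε κ γ : ℝ) (x y : E) : ℝ :=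
  ∑ i, p i * smoothPos ε (γ * G i x + 1) + κ / 2 * ‖x - y‖ ^ 2 + 1 / 2 * ‖x - x₀‖ ^ 2 +
    1 / 2 * (γ - γ₀) ^ 2

lemma sum_smoothStep_mul_eq_zero (hε : ε ≠ 0) {γ : ℝ} {x y : E}
    (h : IsLocalMin (fun γ => penalized p G x₀ γ₀ ε κ γ x y) γ) :
    ∑ i, p i * smoothStep ε (γ * G i x + 1) * G i x + (γ - γ₀) = 0 := by
  have h1 : ∀ i, HasDerivAt (fun γ : ℝ => p i * smoothPos ε (γ * G i x + 1))
      (p i * (smoothStep ε (γ * G i x + 1) * G i x)) γ := fun i =>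
    ((hasDerivAt_smoothPos hε _).comp γ
      ((hasDerivAt_mul_const (G i x)).add_const 1)).const_mul (p i)
  have h2 : HasDerivAt (fun γ : ℝ => 1 / 2 * (γ - γ₀) ^ 2) (γ - γ₀) γ := by
    refine (((hasDerivAt_id γ).sub_const γ₀).pow 2).const_mul (1 / 2 : ℝ) |>.congr_deriv ?_
    simp
  have h3 := h.hasDerivAt_eq_zero ((((HasDerivAt.fun_sum fun i _ => h1 i).add_const
    (κ / 2 * ‖x - y‖ ^ 2)).add_const (1 / 2 * ‖x - x₀‖ ^ 2)).add h2)
  simpa only [mul_assoc] using h3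

lemma exists_isMin_penalized [ProperSpace E] {C : Set E} (hC : IsClosed C) (hx₀ : x₀ ∈ C)
    {r : ℝ} (hr : 0 ≤ r) (hG : ∀ i, ContinuousOn (G i) (Metric.closedBall x₀ r)) :
    ∃ γ ∈ Set.Icc (γ₀ - r) (γ₀ + r), ∃ x ∈ Metric.closedBall x₀ r,
      ∃ y ∈ C ∩ Metric.closedBall x₀ r, ∀ γ' ∈ Set.Icc (γ₀ - r) (γ₀ + r),
        ∀ x' ∈ Metric.closedBall x₀ r, ∀ y' ∈ C ∩ Metric.closedBall x₀ r,
          penalized p G x₀ γ₀ ε κ γ x y ≤ penalized p G x₀ γ₀ ε κ γ' x' y' := by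
  have hK : IsCompact (Set.Icc (γ₀ - r) (γ₀ + r) ×ˢ Metric.closedBall x₀ r ×ˢ
      (C ∩ Metric.closedBall x₀ r)) :=
    isCompact_Icc.prod ((isCompact_closedBall x₀ r).prod ((isCompact_closedBall x₀ r).inter_left hC))
  have hx : x₀ ∈ Metric.closedBall x₀ r := Metric.mem_closedBall_self hr
  have hcont : ContinuousOn (fun z : ℝ × E × E => penalized p G x₀ γ₀ ε κ z.1 z.2.1 z.2.2)
      (Set.Icc (γ₀ - r) (γ₀ + r) ×ˢ Metric.closedBall x₀ r ×ˢ
        (C ∩ Metric.closedBall x₀ r)) := by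
    have hsum : ContinuousOn
        (fun z : ℝ × E × E => ∑ i, p i * smoothPos ε (z.1 * G i z.2.1 + 1))
        (Set.Icc (γ₀ - r) (γ₀ + r) ×ˢ Metric.closedBall x₀ r ×ˢ
          (C ∩ Metric.closedBall x₀ r)) := by
      refine continuousOn_finsetSum _ fun i _ => ?_
      have hGi : ContinuousOn (fun z : ℝ × E × E => G i z.2.1)
          (Set.Icc (γ₀ - r) (γ₀ + r) ×ˢ Metric.closedBall x₀ r ×ˢ
            (C ∩ Metric.closedBall x₀ r)) :=
        (hG i).comp (by fun_prop) fun z hz => hz.2.1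
      have hs : Continuous (smoothPos ε) := by unfold smoothPos; fun_prop
      exact continuousOn_const.mul
        (hs.comp_continuousOn ((continuousOn_fst.mul hGi).add continuousOn_const))
    unfold penalized
    exact ((hsum.add (by fun_prop)).add (by fun_prop)).add (by fun_prop)
  obtain ⟨⟨γ, x, y⟩, ⟨hγ, hx, hy⟩, hmin⟩ := hK.exists_isMinOn
    ⟨(γ₀, x₀, x₀), ⟨by simp [hr], hx, hx₀, hx⟩⟩ hcont
  exact ⟨γ, hγ, x, hx, y, hy, fun γ' hγ' x' hx' y' hy' => hmin (a := (γ', x', y')) ⟨hγ', hx', hy'⟩⟩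

/-- At a minimizer of the penalized problem the penalty and proximal terms are small: replacing `x`
by `y ∈ C`, where the hinge sum is at least its reference value, costs at most `L ‖x - y‖`, and that
is absorbed by the quadratic penalty. -/
lemma penalty_terms_le (hp : ∀ i, 0 ≤ p i) (hε : 0 ≤ ε) (hκ : 0 < κ) {γ L : ℝ} {x y : E}
    (hmin : penalized p G x₀ γ₀ ε κ γ x y ≤ penalized p G x₀ γ₀ ε κ γ₀ x₀ x₀)
    (hLip : hingeSum p G γ y ≤ hingeSum p G γ x + L * ‖x - y‖)
    (hy : hingeSum p G γ₀ x₀ ≤ hingeSum p G γ y) :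
    κ / 4 * ‖x - y‖ ^ 2 + 1 / 2 * ‖x - x₀‖ ^ 2 + 1 / 2 * (γ - γ₀) ^ 2 ≤
      (∑ i, p i) * (ε / 2) + L ^ 2 / κ := by
  have h1 : hingeSum p G γ x ≤ ∑ i, p i * smoothPos ε (γ * G i x + 1) :=
    Finset.sum_le_sum fun i _ => mul_le_mul_of_nonneg_left (max_zero_le_smoothPos _ _) (hp i)
  have h2 : ∑ i, p i * smoothPos ε (γ₀ * G i x₀ + 1) ≤
      hingeSum p G γ₀ x₀ + (∑ i, p i) * (ε / 2) := by
    rw [hingeSum, Finset.sum_mul, ← Finset.sum_add_distrib]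
    refine Finset.sum_le_sum fun i _ => ?_
    rw [← mul_add]
    exact mul_le_mul_of_nonneg_left (smoothPos_le hε _) (hp i)
  have h3 : L * ‖x - y‖ ≤ κ / 4 * ‖x - y‖ ^ 2 + L ^ 2 / κ := by
    have : κ / 4 * ‖x - y‖ ^ 2 + L ^ 2 / κ - L * ‖x - y‖ =
        κ * (‖x - y‖ / 2 - L / κ) ^ 2 := by
      field_simp
      ring
    nlinarith [mul_nonneg hκ.le (sq_nonneg (‖x - y‖ / 2 - L / κ))]
  simp only [penalized, sub_self, norm_zero] at hmin
  linarith

variable [InnerProductSpace ℝ E]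

lemma sum_smoothStep_smul_gradient_eq_zero [CompleteSpace E] (hε : ε ≠ 0) {γ : ℝ} {x y : E}
    (hG : ∀ i, DifferentiableAt ℝ (G i) x)
    (h : IsLocalMin (fun x => penalized p G x₀ γ₀ ε κ γ x y) x) :
    γ • ∑ i, (p i * smoothStep ε (γ * G i x + 1)) • gradient (G i) x + κ • (x - y) +
      (x - x₀) = 0 := by
  have h1 : ∀ i, HasFDerivAt (fun x => p i * smoothPos ε (γ * G i x + 1))
      (p i • smoothStep ε (γ * G i x + 1) • γ • fderiv ℝ (G i) x) x := fun i =>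
    ((hasDerivAt_smoothPos hε _).comp_hasFDerivAt x
      (((hG i).hasFDerivAt.const_mul γ).add_const 1)).const_mul (p i)
  have h2 : ∀ z : E, HasFDerivAt (fun x : E => ‖x - z‖ ^ 2)
      (2 • (innerSL ℝ (x - z)).comp (ContinuousLinearMap.id ℝ E)) x := fun z =>
    ((hasFDerivAt_id x).sub_const z).norm_sq
  have h3 := h.hasFDerivAt_eq_zero ((((HasFDerivAt.fun_sum fun i _ => h1 i).add
    ((h2 y).const_mul (κ / 2))).add ((h2 x₀).const_mul (1 / 2))).add_const (1 / 2 * (γ - γ₀) ^ 2))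
  refine ext_inner_right ℝ fun v => ?_
  have h4 := DFunLike.congr_fun h3 v
  simp only [add_apply, sum_apply,
    smul_apply, ContinuousLinearMap.comp_id, innerSL_apply_apply, smul_eq_mul,
    nsmul_eq_mul, zero_apply] at h4
  simp only [inner_add_left, real_inner_smul_left, sum_inner, inner_gradient_left, inner_zero_left,
    Finset.mul_sum]
  rw [← h4]
  congr 1
  · congr 1
    · exact Finset.sum_congr rfl fun i _ => by ring
    · push_cast; ring
  · push_cast; ring

/-- A displacement from a locally nearest point of `C` is a regular normal. -/
lemma smul_sub_mem_regularNormalCone {C : Set E} (hκ : 0 < κ) {γ : ℝ} {x y : E} (hy : y ∈ C)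
    (h : IsLocalMinOn (fun y => penalized p G x₀ γ₀ ε κ γ x y) C y) :
    κ • (x - y) ∈ regularNormalCone C y := by
  refine ⟨hy, fun δ hδ => ?_⟩
  have hball : Metric.ball y (2 * δ / κ) ∈ 𝓝[C] y :=
    mem_nhdsWithin_of_mem_nhds (Metric.ball_mem_nhds y (by positivity))
  filter_upwards [h, hball] with z hz hzy
  have h1 : κ / 2 * ‖x - y‖ ^ 2 ≤ κ / 2 * ‖x - z‖ ^ 2 := by
    simp only [penalized] at hz
    linarith
  have h2 : ‖x - z‖ ^ 2 = ‖x - y‖ ^ 2 - 2 * inner ℝ (x - y) (z - y) + ‖z - y‖ ^ 2 := by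
    rw [← norm_sub_sq_real, sub_sub_sub_cancel_right]
  have h3 : κ * ‖z - y‖ ≤ 2 * δ := by
    rw [Metric.mem_ball, dist_eq_norm, lt_div_iff₀ hκ] at hzy
    linarith
  rw [real_inner_smul_left]
  nlinarith [norm_nonneg (z - y)]

end Penalized

end BufferedFailure

/-! ### The multiplier rule -/

namespace BufferedFailure

section Multipliers

variable {ι E : Type*} [Fintype ι] [NormedAddCommGroup E] [InnerProductSpace ℝ E]
  [FiniteDimensional ℝ E] {p : ι → ℝ} {G : ι → E → ℝ} {x₀ : E} {γ₀ : ℝ} {C : Set E}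

lemma tendsto_gradient {f : E → ℝ} {x : E} (hf : ContDiffAt ℝ 1 f x) :
    Tendsto (gradient f) (𝓝 x) (𝓝 (gradient f x)) :=
  ((InnerProductSpace.toDual ℝ E).symm.continuous.tendsto _).comp
    (hf.continuousAt_fderiv one_ne_zero)

/-- Approximate stationarity: near a local minimizer `(γ₀, x₀)` of the hinge sum over
`[0, ∞) × C`, the minimizers of the penalized problems converge to `(γ₀, x₀, x₀)` and eventually
lie in the interior of the localizing neighbourhood, so that they satisfy the stationarity
conditions of the penalized problem. -/
lemma exists_approximate_multipliers (hp : ∀ i, 0 ≤ p i) (hC : IsClosed C) (hx₀ : x₀ ∈ C)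
    (hγ₀ : 0 < γ₀) (hG : ∀ i, ContDiffAt ℝ 1 (G i) x₀)
    (hmin : ∀ᶠ x in 𝓝[C] x₀, ∀ γ : ℝ, 0 ≤ γ → hingeSum p G γ₀ x₀ ≤ hingeSum p G γ x) :
    ∃ (ε γ : ℕ → ℝ) (x y w : ℕ → E), Tendsto ε atTop (𝓝 0) ∧ Tendsto γ atTop (𝓝 γ₀) ∧
      Tendsto x atTop (𝓝 x₀) ∧ Tendsto y atTop (𝓝 x₀) ∧ ∀ᶠ k in atTop,
        (∑ i, p i * smoothStep (ε k) (γ k * G i (x k) + 1) * G i (x k) + (γ k - γ₀) = 0) ∧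
        (γ k • ∑ i, (p i * smoothStep (ε k) (γ k * G i (x k) + 1)) • gradient (G i) (x k) + w k +
          (x k - x₀) = 0) ∧ w k ∈ regularNormalCone C (y k) := by
  choose K t ht hKt using fun i => (hG i).hasStrictFDerivAt one_ne_zero |>.exists_lipschitzOnWith
  have hev : ∀ᶠ x in 𝓝 x₀, (∀ i, ContDiffAt ℝ 1 (G i) x) ∧ (∀ i, x ∈ t i) ∧
      (x ∈ C → ∀ γ : ℝ, 0 ≤ γ → hingeSum p G γ₀ x₀ ≤ hingeSum p G γ x) :=
    (eventually_all.2 fun i => (hG i).eventually (by simp)).and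
      ((eventually_all.2 ht).and (eventually_nhdsWithin_iff.1 hmin))
  obtain ⟨r₀, hr₀, hball⟩ := Metric.nhds_basis_closedBall.eventually_iff.1 hev
  -- `r ≤ γ₀` keeps `γ` nonnegative on the localizing interval
  set r := min r₀ γ₀
  have hr : 0 < r := lt_min hr₀ hγ₀
  have hrγ : r ≤ γ₀ := min_le_right _ _
  have hsub : Metric.closedBall x₀ r ⊆ Metric.closedBall x₀ r₀ :=
    Metric.closedBall_subset_closedBall (min_le_left _ _)
  have hLip : ∀ i, LipschitzOnWith (K i) (G i) (Metric.closedBall x₀ r) := fun i =>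
    (hKt i).mono fun z hz => (hball (hsub hz)).2.1 i
  set L := (γ₀ + r) * ∑ i, p i * K i
  set ε : ℕ → ℝ := fun k => 1 / ((k : ℝ) + 1) with hε_def
  set κ : ℕ → ℝ := fun k => (k : ℝ) + 1 with hκ_def
  have hε : ∀ k, 0 < ε k := fun k => by positivity
  have hκ : ∀ k, 1 ≤ κ k := fun k => by simp [hκ_def]
  have hε0 : Tendsto ε atTop (𝓝 0) := tendsto_one_div_add_atTop_nhds_zero_nat
  choose γ hγ x hx y hy hpen using fun k => exists_isMin_penalized (p := p) (γ₀ := γ₀)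
    (ε := ε k) (κ := κ k) hC hx₀ hr.le fun i => (hLip i).continuousOn
  have hx₀r : x₀ ∈ Metric.closedBall x₀ r := Metric.mem_closedBall_self hr.le
  have hbound : ∀ k, κ k / 4 * ‖x k - y k‖ ^ 2 + 1 / 2 * ‖x k - x₀‖ ^ 2 +
      1 / 2 * (γ k - γ₀) ^ 2 ≤ (∑ i, p i) * (ε k / 2) + L ^ 2 / κ k := by
    intro k
    have hγk : 0 ≤ γ k := by linarith [(hγ k).1]
    refine penalty_terms_le hp (hε k).le (zero_lt_one.trans_le (hκ k))
      (hpen k γ₀ ⟨by linarith, by linarith⟩ x₀ hx₀r x₀ ⟨hx₀, hx₀r⟩) ?_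
      ((hball (hsub (hy k).2)).2.2 (hy k).1 _ hγk)
    rw [← dist_eq_norm, dist_comm]
    exact hingeSum_le_add_dist hp hLip hγk (hγ k).2 (hy k).2 (hx k)
  have hb0 : Tendsto (fun k => (∑ i, p i) * (ε k / 2) + L ^ 2 / κ k) atTop (𝓝 0) := by
    have h1 := (hε0.div_const 2).const_mul (∑ i, p i)
    have h2 := hε0.const_mul (L ^ 2)
    simpa [hε_def, hκ_def, div_eq_mul_inv] using h1.add h2
  set b : ℕ → ℝ := fun k => (∑ i, p i) * (ε k / 2) + L ^ 2 / κ k with hb_def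
  have hsqrt : Tendsto (fun k => √(4 * b k)) atTop (𝓝 0) := by
    simpa using (hb0.const_mul 4).sqrt
  -- `κ k ≥ 1`, so the bound controls all three squared distances
  have hsq : ∀ k, ‖x k - y k‖ ^ 2 ≤ 4 * b k ∧ ‖x k - x₀‖ ^ 2 ≤ 4 * b k ∧
      (γ k - γ₀) ^ 2 ≤ 4 * b k := by
    intro k
    have h1 := hbound k
    have h2 : 1 / 4 * ‖x k - y k‖ ^ 2 ≤ κ k / 4 * ‖x k - y k‖ ^ 2 := by
      gcongr
      exact hκ k
    have h3 := sq_nonneg ‖x k - y k‖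
    have h4 := sq_nonneg ‖x k - x₀‖
    have h5 := sq_nonneg (γ k - γ₀)
    refine ⟨?_, ?_, ?_⟩ <;> simp only [hb_def] <;> linarith
  have hγlim : Tendsto γ atTop (𝓝 γ₀) := tendsto_iff_dist_tendsto_zero.2 <|
    squeeze_zero (fun _ => dist_nonneg) (fun k => Real.abs_le_sqrt (hsq k).2.2) hsqrt
  have hxlim : Tendsto x atTop (𝓝 x₀) := tendsto_iff_norm_sub_tendsto_zero.2 <|
    squeeze_zero (fun _ => norm_nonneg _) (fun k => Real.le_sqrt_of_sq_le (hsq k).2.1) hsqrt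
  have hxy : Tendsto (fun k => x k - y k) atTop (𝓝 0) := tendsto_zero_iff_norm_tendsto_zero.2 <|
    squeeze_zero (fun _ => norm_nonneg _) (fun k => Real.le_sqrt_of_sq_le (hsq k).1) hsqrt
  have hylim : Tendsto y atTop (𝓝 x₀) := by simpa using hxlim.sub hxy
  refine ⟨ε, γ, x, y, fun k => κ k • (x k - y k), hε0, hγlim, hxlim, hylim, ?_⟩
  filter_upwards [hγlim.eventually (Ioo_mem_nhds (by linarith : γ₀ - r < γ₀) (by linarith : γ₀ < γ₀ + r)),
    hxlim.eventually (Metric.ball_mem_nhds x₀ hr), hylim.eventually (Metric.ball_mem_nhds x₀ hr)]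
    with k hγk hxk hyk
  refine ⟨sum_smoothStep_mul_eq_zero (x₀ := x₀) (κ := κ k) (y := y k) (hε k).ne' ?_,
    sum_smoothStep_smul_gradient_eq_zero (γ₀ := γ₀) (hε k).ne'
      (fun i => ((hball (hsub (hx k))).1 i).differentiableAt one_ne_zero) ?_,
    smul_sub_mem_regularNormalCone (p := p) (G := G) (x₀ := x₀) (γ₀ := γ₀) (ε := ε k) (γ := γ k)
      (zero_lt_one.trans_le (hκ k)) (hy k).1 ?_⟩
  · filter_upwards [Ioo_mem_nhds hγk.1 hγk.2] with γ' hγ'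
    exact hpen k γ' (Set.Ioo_subset_Icc_self hγ') _ (hx k) _ (hy k)
  · filter_upwards [Metric.isOpen_ball.mem_nhds hxk] with x' hx'
    exact hpen k _ (hγ k) x' (Metric.ball_subset_closedBall hx') _ (hy k)
  · filter_upwards [self_mem_nhdsWithin,
      mem_nhdsWithin_of_mem_nhds (Metric.isOpen_ball.mem_nhds hyk)] with y' hy'C hy'
    exact hpen k _ (hγ k) _ (hx k) y' ⟨hy'C, Metric.ball_subset_closedBall hy'⟩

/-- The multiplier rule for the hinge sum over `[0, ∞) × C`, at a local minimizer `(γ₀, x₀)` with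
`γ₀ > 0`: the multipliers are limits of the derivatives of the smoothed positive part. -/
theorem exists_multipliers (hp : ∀ i, 0 ≤ p i) (hC : IsClosed C) (hx₀ : x₀ ∈ C)
    (hγ₀ : 0 < γ₀) (hG : ∀ i, ContDiffAt ℝ 1 (G i) x₀)
    (hmin : ∀ᶠ x in 𝓝[C] x₀, ∀ γ : ℝ, 0 ≤ γ → hingeSum p G γ₀ x₀ ≤ hingeSum p G γ x) :
    ∃ μ : ι → ℝ, (∀ i, μ i ∈ Set.Icc (0 : ℝ) 1) ∧ ∑ i, p i * μ i * G i x₀ = 0 ∧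
      (∀ i, (γ₀ * G i x₀ + 1 < 0 → μ i = 0) ∧ (0 < γ₀ * G i x₀ + 1 → μ i = 1)) ∧
      -(γ₀ • ∑ i, (p i * μ i) • gradient (G i) x₀) ∈ limitingNormalCone C x₀ := by
  obtain ⟨ε, γ, x, y, w, hε, hγ, hx, hy, hk⟩ :=
    exists_approximate_multipliers hp hC hx₀ hγ₀ hG hmin
  obtain ⟨μ, hμ, φ, hφ, hlim⟩ := (isCompact_univ_pi fun _ : ι =>
    isCompact_Icc (a := (0 : ℝ)) (b := 1)).tendsto_subseq
      (x := fun k i => smoothStep (ε k) (γ k * G i (x k) + 1)) fun k i _ => smoothStep_mem_Icc _ _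
  have hφt := hφ.tendsto_atTop
  have hμlim : ∀ i, Tendsto (fun k => smoothStep (ε (φ k)) (γ (φ k) * G i (x (φ k)) + 1)) atTop
      (𝓝 (μ i)) := fun i => (tendsto_pi_nhds.1 hlim) i
  have hxφ : Tendsto (fun k => x (φ k)) atTop (𝓝 x₀) := hx.comp hφt
  have hγφ : Tendsto (fun k => γ (φ k)) atTop (𝓝 γ₀) := hγ.comp hφt
  have hGlim : ∀ i, Tendsto (fun k => G i (x (φ k))) atTop (𝓝 (G i x₀)) := fun i =>
    (hG i).continuousAt.tendsto.comp hxφ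
  -- where the limiting argument of the positive part is nonzero, the multiplier is determined
  have hτ : ∀ i, γ₀ * G i x₀ + 1 ≠ 0 →
      μ i = (1 + (γ₀ * G i x₀ + 1) / |γ₀ * G i x₀ + 1|) / 2 := fun i hi =>
    tendsto_nhds_unique (hμlim i) (tendsto_smoothStep hi (hε.comp hφt)
      ((hγφ.mul (hGlim i)).add_const 1))
  have hkφ := hφt.eventually hk
  refine ⟨μ, fun i => hμ i (Set.mem_univ i), ?_, fun i => ⟨fun hi => ?_, fun hi => ?_⟩, hx₀, ?_⟩
  · have h1 : Tendsto (fun k => ∑ i, p i * smoothStep (ε (φ k)) (γ (φ k) * G i (x (φ k)) + 1) *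
        G i (x (φ k)) + (γ (φ k) - γ₀)) atTop (𝓝 (∑ i, p i * μ i * G i x₀ + (γ₀ - γ₀))) :=
      (tendsto_finsetSum _ fun i _ => ((hμlim i).const_mul (p i)).mul (hGlim i)).add
        (hγφ.sub_const γ₀)
    rw [sub_self, add_zero] at h1
    exact tendsto_nhds_unique h1 (tendsto_const_nhds.congr' (hkφ.mono fun k h => h.1.symm))
  · rw [hτ i hi.ne, abs_of_neg hi, div_neg, div_self hi.ne]
    norm_num
  · rw [hτ i hi.ne', abs_of_pos hi, div_self hi.ne']
    norm_num
  · have h1 : Tendsto (fun k => -(γ (φ k) • ∑ i, (p i * smoothStep (ε (φ k))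
        (γ (φ k) * G i (x (φ k)) + 1)) • gradient (G i) (x (φ k))) - (x (φ k) - x₀)) atTop
        (𝓝 (-(γ₀ • ∑ i, (p i * μ i) • gradient (G i) x₀) - (x₀ - x₀))) :=
      (hγφ.smul (tendsto_finsetSum _ fun i _ => ((hμlim i).const_mul (p i)).smul
        ((tendsto_gradient (hG i)).comp hxφ))).neg.sub (hxφ.sub_const x₀)
    rw [sub_self, sub_zero] at h1
    have hw : Tendsto (fun k => w (φ k)) atTop
        (𝓝 (-(γ₀ • ∑ i, (p i * μ i) • gradient (G i) x₀))) := by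
      refine h1.congr' (hkφ.mono fun k h => ?_)
      rw [← sub_eq_zero, ← neg_eq_zero, ← h.2.1]
      abel
    obtain ⟨N, hN⟩ := eventually_atTop.1 hkφ
    exact ⟨fun k => y (φ (k + N)), fun k => w (φ (k + N)),
      fun k => (hN _ (Nat.le_add_left N k)).2.2, (hy.comp hφt).comp (tendsto_add_atTop_nat N),
      hw.comp (tendsto_add_atTop_nat N)⟩

end Multipliers

end BufferedFailure

/-! ### The buffered failure probability for a finite distribution -/

namespace BufferedFailure

section FiniteBufferedFailure

variable {Ω S E : Type*} [MeasurableSpace Ω] [MeasurableSpace S] [MeasurableSingletonClass S]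
  {P : Measure Ω} {ξ : Ω → S} {ν : ℕ} {s : Fin ν → S} {p : Fin ν → ℝ}
  {g : S → E → ℝ}

lemma HasFiniteDistribution.integral_max_eq_hingeSum (h : HasFiniteDistribution P ξ s p)
    (g : S → E → ℝ) (γ : ℝ) (x : E) :
    ∫ ω, max 0 (γ * g (ξ ω) x + 1) ∂P = hingeSum p (fun i => g (s i)) γ x :=
  h.integral_comp fun z => max 0 (γ * g z x + 1)

/-- The minimizing `γ` is bounded in terms of `i₀` and `c` alone, hence uniformly in `x`. -/
lemma exists_bufferedFailureProb_eq [IsProbabilityMeasure P]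
    (h : HasFiniteDistribution P ξ s p) {x : E}
    (hneg : ∑ i, p i * g (s i) x < 0) {i₀ : Fin ν} {c : ℝ} (hc : 0 < c) (hi₀ : c ≤ g (s i₀) x) :
    ∃ γ : ℝ, 0 < γ ∧ γ ≤ (p i₀ * c)⁻¹ ∧
      bufferedFailureProb P ξ g x = hingeSum p (fun i => g (s i)) γ x ∧
      ∀ γ' : ℝ, 0 ≤ γ' → bufferedFailureProb P ξ g x ≤ hingeSum p (fun i => g (s i)) γ' x := by
  obtain ⟨γ, hγ, heq, hle⟩ := exists_bprob_eq (h.integrable_comp fun z => g z x)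
    ((h.integral_comp fun z => g z x).trans_lt hneg)
    (h.measure_pos_ne_zero (fun z => g z x) (hc.trans_le hi₀))
  simp only [h.integral_max_eq_hingeSum g] at heq hle
  have h1 : hingeSum p (fun i => g (s i)) 0 x = 1 := by
    rw [← h.integral_max_eq_hingeSum]
    simp
  refine ⟨γ, hγ, ?_, heq, hle⟩
  exact le_of_hingeSum_le_one (fun i => (h.2.1 i).le) hγ.le (h.2.1 i₀) hc hi₀
    (heq ▸ h1 ▸ hle 0 le_rfl)

end FiniteBufferedFailure

end BufferedFailure

theorem mainTheorem3 {Ω : Type*} [MeasurableSpace Ω] (P : Measure Ω) [IsProbabilityMeasure P]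
    {m n ν : ℕ} (ξ : Ω → EuclideanSpace ℝ (Fin m))
    (g : EuclideanSpace ℝ (Fin m) → EuclideanSpace ℝ (Fin n) → ℝ)
    (xhat : EuclideanSpace ℝ (Fin n))
    (s : Fin ν → EuclideanSpace ℝ (Fin m)) (p : Fin ν → ℝ)
    (ha : HasFiniteDistribution P ξ s p)
    (hb : ∀ i, ∃ U : Set (EuclideanSpace ℝ (Fin n)),
      IsOpen U ∧ xhat ∈ U ∧ ContDiffOn ℝ 1 (g (s i)) U)
    (hc : ∫ ω, g (ξ ω) xhat ∂P < 0)
    (hc' : ∃ i, 0 < g (s i) xhat) :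
    (∃ (K : NNReal) (V : Set (EuclideanSpace ℝ (Fin n))),
      V ∈ 𝓝 xhat ∧ LipschitzOnWith K (bufferedFailureProb P ξ g) V) ∧
    ∀ C : Set (EuclideanSpace ℝ (Fin n)), IsClosed C → xhat ∈ C →
      IsLocalMinOn (bufferedFailureProb P ξ g) C xhat →
      ∃ γ ∈ Γset P ξ g xhat, ∃ μ : Fin ν → ℝ,
        (∀ i, μ i ∈ Set.Icc (0 : ℝ) 1) ∧
        ∑ i, p i * μ i * g (s i) xhat = 0 ∧
        (∀ i, (γ * g (s i) xhat + 1 < 0 → μ i = 0) ∧ (0 < γ * g (s i) xhat + 1 → μ i = 1)) ∧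
        -(γ • ∑ i, (p i * μ i) • gradient (g (s i)) xhat) ∈ limitingNormalCone C xhat := by
  have hp : ∀ i, 0 ≤ p i := fun i => (ha.2.1 i).le
  have hG : ∀ i, ContDiffAt ℝ 1 (g (s i)) xhat := fun i => by
    obtain ⟨U, hU, hxU, hUg⟩ := hb i
    exact hUg.contDiffAt (hU.mem_nhds hxU)
  obtain ⟨i₀, hi₀⟩ := hc'
  have hneg : ∑ i, p i * g (s i) xhat < 0 := by
    rwa [← ha.integral_comp fun z => g z xhat]
  have hcont : ContinuousAt (fun x => ∑ i, p i * g (s i) x) xhat :=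
    tendsto_finsetSum _ fun i _ => (hG i).continuousAt.tendsto.const_mul (p i)
  have hc0 : 0 < g (s i₀) xhat / 2 := half_pos hi₀
  -- the minimum formula, with a uniform bound on the minimizer, holds near `xhat`
  have hev : ∀ᶠ x in 𝓝 xhat, ∃ γ : ℝ, 0 < γ ∧ γ ≤ (p i₀ * (g (s i₀) xhat / 2))⁻¹ ∧
      bufferedFailureProb P ξ g x = hingeSum p (fun i => g (s i)) γ x ∧
      ∀ γ' : ℝ, 0 ≤ γ' → bufferedFailureProb P ξ g x ≤ hingeSum p (fun i => g (s i)) γ' x := by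
    filter_upwards [hcont.eventually_lt_const hneg,
      (hG i₀).continuousAt.eventually_const_lt (half_lt_self hi₀)] with x hx1 hx2
    exact exists_bufferedFailureProb_eq ha hx1 hc0 hx2.le
  constructor
  · choose K t ht hKt using fun i =>
      (hG i).hasStrictFDerivAt one_ne_zero |>.exists_lipschitzOnWith
    obtain ⟨W, hW, hWf⟩ := hev.exists_mem
    refine ⟨_, (⋂ i, t i) ∩ W, inter_mem (iInter_mem.2 ht) hW,
      lipschitzOnWith_of_isMin_hingeSum hp (M := (p i₀ * (g (s i₀) xhat / 2))⁻¹)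
        (fun i => (hKt i).mono fun x hx => Set.mem_iInter.1 hx.1 i) (fun x hx => ?_) fun x hx => ?_⟩
    · obtain ⟨γ, h0, h1, h2, -⟩ := hWf x hx.2
      exact ⟨γ, h0.le, h1, h2⟩
    · obtain ⟨-, -, -, -, h3⟩ := hWf x hx.2
      exact h3
  · intro C hC hxC hmin
    obtain ⟨γ, hγ, -, heq, hle⟩ := hev.self_of_nhds
    obtain ⟨μ, h1, h2, h3, h4⟩ := exists_multipliers (G := fun i => g (s i)) hp hC hxC hγ hG (by
      filter_upwards [hmin, nhdsWithin_le_nhds hev] with x hx hx' γ' hγ'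
      obtain ⟨-, -, -, -, h⟩ := hx'
      exact heq ▸ hx.trans (h γ' hγ'))
    refine ⟨γ, ⟨hγ.le, fun γ' hγ' => ?_⟩, μ, h1, h2, h3, h4⟩
    rw [ha.integral_max_eq_hingeSum g, ha.integral_max_eq_hingeSum g, ← heq]
    exact hle γ' hγ'
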